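/- An algebraic circuit over a field $\mathbb{F}$ is a finite directed acyclic graph whose leaves are labelled by variables or by constants of $\mathbb{F}$ and whose other gates are sum or product gates of unbounded fan-in, with a designated output; its size is its number of nodes and wires, and its depth is the length of a longest path from a leaf to the output. Let $\mathbf{x}=(x_1,\dots,x_n)$, let $y$ be a further variable, and write $\mathrm{Esym}_r$ for the $r$-th elementary symmetric polynomial. The quantities $O(1)$, the polynomials $\mathrm{poly}(\cdot)$ and the exponents $c$ below are absolute (they do not depend on the field, on the polynomials, or on any of the parameters). (1) There is an absolute constant $c$ such that the following holds. Let $\mathbb{F}$ be a field, of any characteristic, with $|\mathbb{F}| \ge (s d_1 d_2 n)^c$, and let $f,g\in\mathbb{F}[\mathbf{x},y]$ be monic in $y$, of degrees $d_1$ and $d_2$ in $y$ respectively, each computed by a circuit over $\mathbb{F}$ of size at most $s$ and depth at most $\Delta$. Let $\{\sigma_1,\dots,\sigma_{d_1}\}$ be the multiset of $y$-roots of $f$ in $\overline{\mathbb{F}(\mathbf{x})}$. Then, for every $1\le r\le d_1$, the element $$\mathrm{Esym}_r\big(g(\mathbf{x},\sigma_1),\dots,g(\mathbf{x},\sigma_{d_1})\big)$$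 lies in $\mathbb{F}[\mathbf{x}]$ and is computed by a circuit over $\mathbb{F}$ of size $\mathrm{poly}(s,n,d_1,d_2)$ and depth $\Delta+O(1)$. (2) There is an absolute constant $c$ such that the following holds. Let $f,g,h\in\mathbb{F}[\mathbf{x},y]$ be monic in $y$, of degrees $d_f,d_g,d_h$ in $y$ respectively, with $\gcd(f,h)=1$, each computed by a circuit over $\mathbb{F}$ of size at most $s$ and depth at most $\Delta$; let $d=\max(d_f,d_g,d_h)$ and suppose $|\mathbb{F}|\ge (sdn)^c$. Let $\{\sigma_1,\dots,\sigma_{d_f}\}$ be the multiset of $y$-roots of $f$ in $\overline{\mathbb{F}(\mathbf{x})}$. Then $h(\mathbf{x},\sigma_i)\ne 0$ for all $i$, and for every $1\le r\le d_f$ there are polynomials $A,B\in\mathbb{F}[\mathbf{x}]$ with $B\neq 0$, each computed by a circuit over $\mathbb{F}$ of size $\mathrm{poly}(s,n,d)$ and depth $\Delta+O(1)$, such that $$\mathrm{Esym}_r\left(\frac{g(\mathbf{x},\sigma_1)}{h(\mathbf{x},\sigma_1)},\dots,\frac{g(\mathbf{x},\sigma_{d_f})}{h(\mathbf{x},\sigma_{d_f})}\right)=\frac{A(\mathbf{x})}{B(\mathbf{x})}.$$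 -/

import Mathlib

universe u v w

/-- A gate of an algebraic circuit over `F` in the variables `V`; the type `W` names the nodes of
the circuit.  Sum and product gates have unbounded fan-in, and an input may occur repeatedly. -/
inductive Gate (F : Type u) (V : Type v) (W : Type w) where
  | var (x : V)
  | const (a : F)
  | sum (l : List W)
  | prod (l : List W)

namespace Gate

variable {F : Type u} {V : Type v} {W : Type w}

/-- The nodes wired into a gate, with multiplicity. -/
def inputs : Gate F V W → List W
  | var _ => []
  | const _ => []
  | sum l => l
  | prod l => l

/-- The polynomial computed at a gate, given the polynomials computed at its inputs. -/
noncomputable def evalWith [CommSemiring F] :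
    (g : Gate F V W) → ((i : W) → i ∈ g.inputs → MvPolynomial V F) → MvPolynomial V F
  | var x, _ => MvPolynomial.X x
  | const a, _ => MvPolynomial.C a
  | sum l, p => (l.attach.map fun i => p i.1 i.2).sum
  | prod l, p => (l.attach.map fun i => p i.1 i.2).prod

/-- The depth of a gate, given the depths of its inputs: leaves have depth `0`, a sum or product
gate is one deeper than its deepest input. -/
def depthWith : (g : Gate F V W) → ((i : W) → i ∈ g.inputs → ℕ) → ℕ
  | var _, _ => 0
  | const _, _ => 0
  | sum l, p => (l.attach.map fun i => p i.1 i.2).foldr max 0 + 1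
  | prod l, p => (l.attach.map fun i => p i.1 i.2).foldr max 0 + 1

end Gate

/-- An algebraic circuit over `F` in the variables `V`: a finite directed acyclic graph of gates
with a designated output node. For a finite graph, being acyclic is the same as the
well-foundedness of the relation "`i` is an input of `j`". -/
structure AlgCircuit (F : Type u) (V : Type v) where
  Node : Type
  nodeFintype : Fintype Node
  gate : Node → Gate F V Node
  acyclic : WellFounded fun i j : Node => i ∈ (gate j).inputs
  output : Node

attribute [instance] AlgCircuit.nodeFintype

namespace AlgCircuit

variable {F : Type u} {V : Type v}

/-- The polynomial computed at a node. -/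
noncomputable def nodePoly [CommSemiring F] (C : AlgCircuit F V) : C.Node → MvPolynomial V F :=
  C.acyclic.fix fun j p => (C.gate j).evalWith p

/-- The length of a longest directed path from a leaf to a node. -/
noncomputable def nodeDepth (C : AlgCircuit F V) : C.Node → ℕ :=
  C.acyclic.fix fun j p => (C.gate j).depthWith p

theorem nodePoly_eq [CommSemiring F] (C : AlgCircuit F V) (j : C.Node) :
    C.nodePoly j = (C.gate j).evalWith fun i _ => C.nodePoly i :=
  C.acyclic.fix_eq _ j

theorem nodeDepth_eq (C : AlgCircuit F V) (j : C.Node) :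
    C.nodeDepth j = (C.gate j).depthWith fun i _ => C.nodeDepth i :=
  C.acyclic.fix_eq _ j

/-- The polynomial computed by a circuit. -/
noncomputable def poly [CommSemiring F] (C : AlgCircuit F V) : MvPolynomial V F :=
  C.nodePoly C.output

/-- The depth of a circuit: the length of a longest directed path from a leaf to the output. -/
noncomputable def depth (C : AlgCircuit F V) : ℕ :=
  C.nodeDepth C.output

/-- The size of a circuit: the number of its nodes and wires. -/
def size (C : AlgCircuit F V) : ℕ :=
  ∑ j : C.Node, (1 + (C.gate j).inputs.length)

end AlgCircuit

/-- `p` is computed by an algebraic circuit over `F` of size at most `s` and depth at most `Δ`. -/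
def HasCircuit {F : Type u} {V : Type v} [CommSemiring F] (p : MvPolynomial V F) (s Δ : ℕ) :
    Prop :=
  ∃ C : AlgCircuit F V, C.poly = p ∧ C.size ≤ s ∧ C.depth ≤ Δ

section YRoots

variable {F : Type u} [Field F] {n : ℕ}

/-- A polynomial `f(x₁, …, xₙ, y)`, the variable `y` being `none` and `xᵢ` being `some i`, viewed as
a univariate polynomial in `y` over `F[x₁, …, xₙ]`. -/
noncomputable def inY (f : MvPolynomial (Option (Fin n)) F) :
    Polynomial (MvPolynomial (Fin n) F) :=
  MvPolynomial.optionEquivLeft F (Fin n) f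

/-- The algebraic closure of the field `F(x₁, …, xₙ)` of rational functions. -/
abbrev RatFunClosure (F : Type u) [Field F] (n : ℕ) : Type u :=
  AlgebraicClosure (FractionRing (MvPolynomial (Fin n) F))

/-- The multiset of `y`-roots of `f` in the algebraic closure of `F(x₁, …, xₙ)`. -/
noncomputable def yRoots (f : MvPolynomial (Option (Fin n)) F) : Multiset (RatFunClosure F n) :=
  (inY f).aroots (RatFunClosure F n)

/-- The value `g(x, σ)` for `σ` in the algebraic closure of `F(x₁, …, xₙ)`. -/
noncomputable def evalY (g : MvPolynomial (Option (Fin n)) F) (σ : RatFunClosure F n) :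
    RatFunClosure F n :=
  Polynomial.aeval σ (inY g)

/-- A polynomial in `F[x₁, …, xₙ]` as an element of the algebraic closure of `F(x₁, …, xₙ)`. -/
noncomputable def toClosure (p : MvPolynomial (Fin n) F) : RatFunClosure F n :=
  algebraMap (MvPolynomial (Fin n) F) (RatFunClosure F n) p

end YRoots

/-! Over the closure, the resultant in `y` of `f` and `g + t h` is the product of `g(σ) + t h(σ)`
over the roots `σ` of `f`. With `d` the degree of `f`, its coefficient of `t ^ (d - r)` is the
product of all `h(σ)` times the `r`-th elementary symmetric function of the quotients
(`esymm_div_eq`). The denominator is thus the resultant of `f` and `h`, which is `1` for `h = 1`. It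
remains to compute resultants with constant extra depth.

Take distinct constants `α i`, let `f₀` be the product of the `y - α i`, and deform `f₀` to `f`
along `f₀ + z (f - f₀)`. Modulo `z ^ N` each simple root `α i` lifts to `α i + τ i` with `τ i`
nilpotent, so the resultant becomes the product of the `g(α i + τ i)`. After shifting by `α i` the
deformed polynomial is `P = X v + z q`, and `g(α i + τ i)` is the residue at `0` of the shifted `g`
times `P' / P`. Modulo `z ^ N` the geometric series for `1 / P` is finite, so the residue is one
coefficient of an explicit polynomial (`residueValue_eq_eval`). No factorial is inverted, hence no
condition on the characteristic. For `N` beyond the degree of the resultant in `z`, truncation loses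
nothing, and the value at `z = 1` is a sum of coefficients (`resultant_eq_sum_coeff_prod`).

Coefficients in `t`, `z` and `X` are all extracted by interpolation at field constants
(`CircuitLevel.coeff_of_eval`), which needs a large field. The whole is a fixed number of sum,
product and interpolation layers. -/

open Polynomial

/-! ### Circuit surgery: substitution and joining. -/

namespace Gate

variable {F : Type u} {V V' : Type v} {W W' : Type w}

/-- Relabel the nodes of a gate along `e` and substitute a variable or a constant for each
variable. -/
def subst (ℓ : V → V' ⊕ F) (e : W → W') : Gate F V W → Gate F V' W'
  | var x => Sum.elim var const (ℓ x)
  | const a => const a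
  | sum l => sum (l.map e)
  | prod l => prod (l.map e)

theorem inputs_subst (ℓ : V → V' ⊕ F) (e : W → W') (g : Gate F V W) :
    (g.subst ℓ e).inputs = g.inputs.map e := by
  cases g with
  | var x => cases h : ℓ x <;> simp [subst, inputs, h]
  | _ => simp [subst, inputs]

theorem evalWith_sum [CommSemiring F] (l : List W) (p : W → MvPolynomial V F) :
    (Gate.sum l).evalWith (fun i _ => p i) = (l.map p).sum := by
  simp [evalWith]

theorem evalWith_prod [CommSemiring F] (l : List W) (p : W → MvPolynomial V F) :
    (Gate.prod l).evalWith (fun i _ => p i) = (l.map p).prod := by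
  simp [evalWith]

theorem depthWith_sum (l : List W) (p : W → ℕ) :
    (Gate.sum l : Gate F V W).depthWith (fun i _ => p i) = (l.map p).foldr max 0 + 1 := by
  simp [depthWith]

theorem depthWith_prod (l : List W) (p : W → ℕ) :
    (Gate.prod l : Gate F V W).depthWith (fun i _ => p i) = (l.map p).foldr max 0 + 1 := by
  simp [depthWith]

theorem inputs_sum (l : List W) : (Gate.sum l : Gate F V W).inputs = l := rfl

theorem inputs_prod (l : List W) : (Gate.prod l : Gate F V W).inputs = l := rfl

end Gate

namespace AlgCircuit

variable {F : Type u} {V V' : Type v}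

/-- The map `e` need not be onto, so this covers both substitution in one circuit (`e = id`) and the
inclusion of a circuit into a join. -/
theorem nodePoly_of_gate_eq_subst [CommSemiring F] (C : AlgCircuit F V) (D : AlgCircuit F V')
    (ℓ : V → V' ⊕ F) (e : C.Node → D.Node) (h : ∀ j, D.gate (e j) = (C.gate j).subst ℓ e)
    (j : C.Node) :
    D.nodePoly (e j) =
      MvPolynomial.aeval (fun x => Sum.elim MvPolynomial.X MvPolynomial.C (ℓ x))
        (C.nodePoly j) := by
  induction j using C.acyclic.induction with
  | _ j ih =>
    rw [nodePoly_eq, nodePoly_eq, h]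
    cases hg : C.gate j with
    | var x =>
      cases hx : ℓ x with
      | inl v =>
        have : (Gate.var x).subst ℓ e = Gate.var v := by simp [Gate.subst, hx]
        rw [this]
        simp [Gate.evalWith, hx]
      | inr a =>
        have : (Gate.var x).subst ℓ e = Gate.const a := by simp [Gate.subst, hx]
        rw [this]
        simp [Gate.evalWith, hx]
    | const a => simp [Gate.subst, Gate.evalWith]
    | sum l =>
      simp only [Gate.subst, Gate.evalWith, List.map_attach_eq_pmap, List.pmap_eq_map, List.map_map,
        map_list_sum]
      exact congrArg List.sum (List.map_congr_left fun i hi => ih i (by rw [hg]; exact hi))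
    | prod l =>
      simp only [Gate.subst, Gate.evalWith, List.map_attach_eq_pmap, List.pmap_eq_map, List.map_map,
        map_list_prod]
      exact congrArg List.prod (List.map_congr_left fun i hi => ih i (by rw [hg]; exact hi))

theorem nodeDepth_of_gate_eq_subst (C : AlgCircuit F V) (D : AlgCircuit F V')
    (ℓ : V → V' ⊕ F) (e : C.Node → D.Node) (h : ∀ j, D.gate (e j) = (C.gate j).subst ℓ e)
    (j : C.Node) : D.nodeDepth (e j) = C.nodeDepth j := by
  induction j using C.acyclic.induction with
  | _ j ih =>
    rw [nodeDepth_eq, nodeDepth_eq, h]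
    cases hg : C.gate j with
    | var x =>
      cases hx : ℓ x with
      | inl v =>
        have : (Gate.var x).subst ℓ e = Gate.var v := by simp [Gate.subst, hx]
        rw [this]
        simp [Gate.depthWith]
      | inr a =>
        have : (Gate.var x).subst ℓ e = Gate.const a := by simp [Gate.subst, hx]
        rw [this]
        simp [Gate.depthWith]
    | const a => simp [Gate.subst, Gate.depthWith]
    | sum l =>
      simp only [Gate.subst, Gate.depthWith, List.map_attach_eq_pmap, List.pmap_eq_map,
        List.map_map]
      exact congrArg (fun l : List ℕ => l.foldr max 0 + 1)
        (List.map_congr_left fun i hi => ih i (by rw [hg]; exact hi))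
    | prod l =>
      simp only [Gate.subst, Gate.depthWith, List.map_attach_eq_pmap, List.pmap_eq_map,
        List.map_map]
      exact congrArg (fun l : List ℕ => l.foldr max 0 + 1)
        (List.map_congr_left fun i hi => ih i (by rw [hg]; exact hi))

/-- Substitute a variable or a constant for each variable of a circuit. -/
def subst (C : AlgCircuit F V) (ℓ : V → V' ⊕ F) : AlgCircuit F V' where
  Node := C.Node
  nodeFintype := C.nodeFintype
  gate j := (C.gate j).subst ℓ id
  acyclic := by
    convert C.acyclic using 3
    simp [Gate.inputs_subst]
  output := C.output

/-- The circuit with a single node. -/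
def leaf (a : F) : AlgCircuit F V where
  Node := Unit
  nodeFintype := inferInstance
  gate _ := .const a
  acyclic := ⟨fun _ => ⟨_, fun _ h => by simp [Gate.inputs] at h⟩⟩
  output := ()

/-- Join a family of circuits by a top gate, whose inputs are their outputs. -/
def join {m : ℕ} (C : Fin m → AlgCircuit F V)
    (top : List (Option (Σ i, (C i).Node)) → Gate F V (Option (Σ i, (C i).Node)))
    (htop : ∀ l, (top l).inputs = l) : AlgCircuit F V where
  Node := Option (Σ i, (C i).Node)
  nodeFintype := inferInstance
  gate
    | none => top (List.ofFn fun i => some ⟨i, (C i).output⟩)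
    | some x => ((C x.1).gate x.2).subst Sum.inl fun j => some ⟨x.1, j⟩
  acyclic := by
    have key : ∀ i (j : (C i).Node), Acc (fun a b : Option (Σ i, (C i).Node) =>
        a ∈ Gate.inputs (match b with
          | none => top (List.ofFn fun i => some ⟨i, (C i).output⟩)
          | some x => ((C x.1).gate x.2).subst Sum.inl fun j => some ⟨x.1, j⟩))
        (some ⟨i, j⟩) := by
      intro i j
      induction j using (C i).acyclic.induction with
      | _ j ih =>
        refine ⟨_, fun a ha => ?_⟩
        simp only [Gate.inputs_subst, List.mem_map] at ha
        obtain ⟨k, hk, rfl⟩ := ha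
        exact ih k hk
    refine ⟨fun a => ?_⟩
    cases a with
    | some x => exact key x.1 x.2
    | none =>
      refine ⟨_, fun a ha => ?_⟩
      simp only [htop, List.mem_ofFn] at ha
      obtain ⟨i, rfl⟩ := ha
      exact key i _
  output := none

section join

variable {m : ℕ} (C : Fin m → AlgCircuit F V)
  (top : List (Option (Σ i, (C i).Node)) → Gate F V (Option (Σ i, (C i).Node)))
  (htop : ∀ l, (top l).inputs = l)

theorem join_nodePoly [CommSemiring F] (i : Fin m) (j : (C i).Node) :
    (join C top htop).nodePoly (some ⟨i, j⟩) = (C i).nodePoly j := by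
  have := nodePoly_of_gate_eq_subst (C i) (join C top htop) Sum.inl (fun j => some ⟨i, j⟩)
    (fun _ => rfl) j
  simpa [MvPolynomial.aeval_X_left] using this

theorem join_nodeDepth (i : Fin m) (j : (C i).Node) :
    (join C top htop).nodeDepth (some ⟨i, j⟩) = (C i).nodeDepth j :=
  nodeDepth_of_gate_eq_subst (C i) (join C top htop) Sum.inl (fun j => some ⟨i, j⟩)
    (fun _ => rfl) j

theorem map_join_nodePoly [CommSemiring F] :
    (List.ofFn fun i => (some ⟨i, (C i).output⟩ : Option (Σ i, (C i).Node))).map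
      (join C top htop).nodePoly = List.ofFn fun i => (C i).poly := by
  refine (List.map_ofFn ..).trans (congrArg List.ofFn (funext fun i => ?_))
  exact join_nodePoly C top htop i _

theorem map_join_nodeDepth :
    (List.ofFn fun i => (some ⟨i, (C i).output⟩ : Option (Σ i, (C i).Node))).map
      (join C top htop).nodeDepth = List.ofFn fun i => (C i).depth := by
  refine (List.map_ofFn ..).trans (congrArg List.ofFn (funext fun i => ?_))
  exact join_nodeDepth C top htop i _

theorem join_size : (join C top htop).size = 1 + m + ∑ i, (C i).size := by
  have : (join C top htop).size = ∑ x : Option (Σ i, (C i).Node),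
      (1 + ((join C top htop).gate x).inputs.length) := rfl
  rw [this, Fintype.sum_option, Fintype.sum_sigma]
  simp [join, htop, Gate.inputs_subst, size]

end join

end AlgCircuit

namespace HasCircuit

variable {F : Type u} {V : Type v}

theorem mono [CommSemiring F] {p : MvPolynomial V F} {s s' Δ Δ' : ℕ} (h : HasCircuit p s Δ)
    (hs : s ≤ s') (hΔ : Δ ≤ Δ') : HasCircuit p s' Δ' := by
  obtain ⟨C, hC, h1, h2⟩ := h
  exact ⟨C, hC, h1.trans hs, h2.trans hΔ⟩

theorem C [CommSemiring F] (a : F) : HasCircuit (MvPolynomial.C a : MvPolynomial V F) 1 0 := by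
  refine ⟨AlgCircuit.leaf a, ?_, ?_, ?_⟩
  · rw [AlgCircuit.poly, AlgCircuit.nodePoly_eq]; rfl
  · simp only [AlgCircuit.size, AlgCircuit.leaf, Gate.inputs, List.length_nil]
    exact le_rfl
  · rw [AlgCircuit.depth, AlgCircuit.nodeDepth_eq]; simp [AlgCircuit.leaf, Gate.depthWith]

theorem subst [CommSemiring F] {V' : Type v} {p : MvPolynomial V F} {s Δ : ℕ}
    (h : HasCircuit p s Δ) (ℓ : V → V' ⊕ F) :
    HasCircuit (MvPolynomial.aeval (fun x => Sum.elim MvPolynomial.X MvPolynomial.C (ℓ x)) p :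
      MvPolynomial V' F) s Δ := by
  obtain ⟨C, rfl, h1, h2⟩ := h
  refine ⟨C.subst ℓ, ?_, ?_, ?_⟩
  · exact C.nodePoly_of_gate_eq_subst (C.subst ℓ) ℓ id (fun _ => rfl) C.output
  · refine le_trans (le_of_eq ?_) h1
    simp only [AlgCircuit.size, AlgCircuit.subst, Gate.inputs_subst, List.length_map]
    rfl
  · exact (C.nodeDepth_of_gate_eq_subst (C.subst ℓ) ℓ id (fun _ => rfl) C.output).trans_le h2

theorem foldr_max_le {l : List ℕ} {b : ℕ} (h : ∀ x ∈ l, x ≤ b) : l.foldr max 0 ≤ b := by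
  induction l with
  | nil => simp
  | cons a l ih => simp_all

theorem sum_fin [CommSemiring F] {m s Δ : ℕ} {p : Fin m → MvPolynomial V F}
    (h : ∀ i, HasCircuit (p i) s Δ) : HasCircuit (∑ i, p i) (m * (s + 1) + 1) (Δ + 1) := by
  choose C hp hs hd using h
  refine ⟨AlgCircuit.join C .sum Gate.inputs_sum, ?_, ?_, ?_⟩
  · rw [AlgCircuit.poly, AlgCircuit.nodePoly_eq]
    refine (Gate.evalWith_sum (List.ofFn fun i =>
      (some ⟨i, (C i).output⟩ : Option (Σ i, (C i).Node))) _).trans ?_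
    refine (congrArg List.sum (AlgCircuit.map_join_nodePoly C _ _)).trans ?_
    rw [List.sum_ofFn]
    exact Finset.sum_congr rfl fun i _ => hp i
  · rw [AlgCircuit.join_size]
    have := Finset.sum_le_card_nsmul Finset.univ (fun i => (C i).size) s fun i _ => hs i
    simp only [Finset.card_univ, Fintype.card_fin, smul_eq_mul] at this
    linarith
  · rw [AlgCircuit.depth, AlgCircuit.nodeDepth_eq]
    refine (Gate.depthWith_sum (List.ofFn fun i =>
      (some ⟨i, (C i).output⟩ : Option (Σ i, (C i).Node))) _).trans_le ?_
    refine (congrArg (fun l : List ℕ => l.foldr max 0 + 1)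
      (AlgCircuit.map_join_nodeDepth C _ _)).trans_le ?_
    refine Nat.succ_le_succ (foldr_max_le fun x hx => ?_)
    obtain ⟨i, rfl⟩ := List.mem_ofFn.1 hx
    exact hd i

theorem prod_fin [CommSemiring F] {m s Δ : ℕ} {p : Fin m → MvPolynomial V F}
    (h : ∀ i, HasCircuit (p i) s Δ) : HasCircuit (∏ i, p i) (m * (s + 1) + 1) (Δ + 1) := by
  choose C hp hs hd using h
  refine ⟨AlgCircuit.join C .prod Gate.inputs_prod, ?_, ?_, ?_⟩
  · rw [AlgCircuit.poly, AlgCircuit.nodePoly_eq]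
    refine (Gate.evalWith_prod (List.ofFn fun i =>
      (some ⟨i, (C i).output⟩ : Option (Σ i, (C i).Node))) _).trans ?_
    refine (congrArg List.prod (AlgCircuit.map_join_nodePoly C _ _)).trans ?_
    rw [List.prod_ofFn]
    exact Finset.prod_congr rfl fun i _ => hp i
  · rw [AlgCircuit.join_size]
    have := Finset.sum_le_card_nsmul Finset.univ (fun i => (C i).size) s fun i _ => hs i
    simp only [Finset.card_univ, Fintype.card_fin, smul_eq_mul] at this
    linarith
  · rw [AlgCircuit.depth, AlgCircuit.nodeDepth_eq]
    refine (Gate.depthWith_prod (List.ofFn fun i =>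
      (some ⟨i, (C i).output⟩ : Option (Σ i, (C i).Node))) _).trans_le ?_
    refine (congrArg (fun l : List ℕ => l.foldr max 0 + 1)
      (AlgCircuit.map_join_nodeDepth C _ _)).trans_le ?_
    refine Nat.succ_le_succ (foldr_max_le fun x hx => ?_)
    obtain ⟨i, rfl⟩ := List.mem_ofFn.1 hx
    exact hd i

end HasCircuit

/-- `p` is computed by a circuit of size at most `M ^ (k + 1)` and depth at most `Δ + k`. -/
def CircuitLevel {F : Type u} {V : Type v} [CommSemiring F] (M Δ k : ℕ) (p : MvPolynomial V F) :
    Prop :=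
  HasCircuit p (M ^ (k + 1)) (Δ + k)

/-! ### Bookkeeping of size and depth; interpolation. -/

namespace CircuitLevel

variable {F : Type u} {V : Type v} {M Δ k k' : ℕ}

section semiring

variable [CommSemiring F]

theorem mono {p : MvPolynomial V F} (hM : 2 ≤ M) (h : CircuitLevel M Δ k p) (hk : k ≤ k') :
    CircuitLevel M Δ k' p :=
  HasCircuit.mono h (Nat.pow_le_pow_right (by omega) (by omega)) (by omega)

theorem const (hM : 2 ≤ M) (k : ℕ) (a : F) :
    CircuitLevel M Δ k (MvPolynomial.C a : MvPolynomial V F) :=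
  (HasCircuit.C a).mono (Nat.one_le_pow _ _ (by omega)) (by omega)

/-- Joining `M` circuits costs slightly more than a factor `M`. Charging two levels per gate absorbs
the excess; the depth bound is then generous by one per gate. -/
theorem size_step (hM : 2 ≤ M) {m : ℕ} (hm : m ≤ M) (k : ℕ) :
    m * (M ^ (k + 1) + 1) + 1 ≤ M ^ (k + 2 + 1) := by
  have h1 : M ≤ M ^ (k + 1) := Nat.le_self_pow (by omega) M
  calc m * (M ^ (k + 1) + 1) + 1 ≤ M * (M ^ (k + 1) + 1) + 1 := by gcongr
    _ ≤ M * (2 * M ^ (k + 1)) := by nlinarith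
    _ ≤ M * (M * M ^ (k + 1)) := by gcongr
    _ = M ^ (k + 2 + 1) := by ring

theorem sum (hM : 2 ≤ M) {ι : Type*} (t : Finset ι) (ht : t.card ≤ M)
    {p : ι → MvPolynomial V F} (h : ∀ i ∈ t, CircuitLevel M Δ k (p i)) :
    CircuitLevel M Δ (k + 2) (∑ i ∈ t, p i) := by
  have := HasCircuit.sum_fin (p := fun i => p (t.equivFin.symm i))
    (fun i => h _ (t.equivFin.symm i).2)
  rw [Equiv.sum_comp t.equivFin.symm (fun i : t => p i), Finset.sum_coe_sort] at this
  exact this.mono (size_step hM ht k) (by omega)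

theorem prod (hM : 2 ≤ M) {ι : Type*} (t : Finset ι) (ht : t.card ≤ M)
    {p : ι → MvPolynomial V F} (h : ∀ i ∈ t, CircuitLevel M Δ k (p i)) :
    CircuitLevel M Δ (k + 2) (∏ i ∈ t, p i) := by
  have := HasCircuit.prod_fin (p := fun i => p (t.equivFin.symm i))
    (fun i => h _ (t.equivFin.symm i).2)
  rw [Equiv.prod_comp t.equivFin.symm (fun i : t => p i), Finset.prod_coe_sort] at this
  exact this.mono (size_step hM ht k) (by omega)

theorem add (hM : 2 ≤ M) {p q : MvPolynomial V F} (hp : CircuitLevel M Δ k p)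
    (hq : CircuitLevel M Δ k q) : CircuitLevel M Δ (k + 2) (p + q) := by
  have := sum hM (Finset.univ : Finset (Fin 2)) (by simpa using hM) (p := ![p, q])
    (Δ := Δ) (k := k) (by simp [hp, hq])
  simpa using this

theorem mul (hM : 2 ≤ M) {p q : MvPolynomial V F} (hp : CircuitLevel M Δ k p)
    (hq : CircuitLevel M Δ k q) : CircuitLevel M Δ (k + 2) (p * q) := by
  have := prod hM (Finset.univ : Finset (Fin 2)) (by simpa using hM) (p := ![p, q])
    (Δ := Δ) (k := k) (by simp [hp, hq])
  simpa using this

theorem pow (hM : 2 ≤ M) {p : MvPolynomial V F} (hp : CircuitLevel M Δ k p) {e : ℕ} (he : e ≤ M) :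
    CircuitLevel M Δ (k + 2) (p ^ e) := by
  have := prod hM (Finset.range e) (by simpa using he) (p := fun _ => p)
    (Δ := Δ) (k := k) (fun _ _ => hp)
  simpa using this

/-- The values at constants of a polynomial whose coefficients have small circuits. -/
theorem eval (hM : 2 ≤ M) {P : (MvPolynomial V F)[X]} (hP : P.natDegree < M)
    (h : ∀ j, CircuitLevel M Δ k (P.coeff j)) (b : F) :
    CircuitLevel M Δ (k + 4) (P.eval (MvPolynomial.C b)) := by
  rw [Polynomial.eval_eq_sum_range]
  refine sum hM _ (by simpa using hP) fun j _ => mul hM (h j) ?_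
  rw [← map_pow]
  exact const hM _ _

end semiring

/-- The coefficients of a polynomial whose values at constants have small circuits. -/
theorem coeff_of_eval [Field F] (hM : 2 ≤ M) {P : (MvPolynomial V F)[X]} (hP : P.natDegree < M)
    (e : Fin M ↪ F) (h : ∀ b : F, CircuitLevel M Δ k (P.eval (MvPolynomial.C b))) (j : ℕ) :
    CircuitLevel M Δ (k + 4) (P.coeff j) := by
  by_cases hj : M ≤ j
  · rw [Polynomial.coeff_eq_zero_of_natDegree_lt (by omega), ← MvPolynomial.C_0]
    exact const hM _ _
  obtain ⟨j, rfl⟩ : ∃ j' : Fin M, (j' : ℕ) = j := ⟨⟨j, by omega⟩, rfl⟩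
  -- The inverse Vandermonde matrix has entries in `F`, so a coefficient is a fixed `F`-linear
  -- combination of `M` values.
  set A := Matrix.vandermonde (fun i => e i) with hA
  have hdet : IsUnit A.det :=
    isUnit_iff_ne_zero.2 (Matrix.det_vandermonde_ne_zero_iff.2 e.injective)
  have hinv : A⁻¹ * A = 1 := Matrix.nonsing_inv_mul A hdet
  have key : P.coeff j =
      ∑ i : Fin M, MvPolynomial.C (A⁻¹ j i) * P.eval (MvPolynomial.C (e i)) := by
    have h1 : ∀ i : Fin M, P.eval (MvPolynomial.C (e i)) =
        ∑ l : Fin M, P.coeff l * MvPolynomial.C (A i l) := by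
      intro i
      rw [Polynomial.eval_eq_sum_range' hP,
        Finset.sum_range (fun l => P.coeff l * (MvPolynomial.C (e i)) ^ l)]
      simp [hA, Matrix.vandermonde_apply]
    calc P.coeff j = ∑ l : Fin M, P.coeff l * MvPolynomial.C ((A⁻¹ * A) j l) := by
          simp [hinv, Matrix.one_apply, apply_ite MvPolynomial.C]
      _ = _ := by
          simp_rw [h1, Matrix.mul_apply, map_sum, map_mul, Finset.mul_sum]
          rw [Finset.sum_comm]
          exact Finset.sum_congr rfl fun i _ => Finset.sum_congr rfl fun l _ => by ring
  rw [key]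
  exact sum hM _ (by simp) fun i _ => mul hM (const hM _ _) (h _)

end CircuitLevel

/-! ### Values at a nilpotent root as residues. -/

section Residue

/-- The coefficient of `X ^ (N - 1)` in `h P' T V`, where `P = X v + z q` and `T P = (X v) ^ N`
if `z ^ N = 0`.  If moreover `V` inverts `v ^ N` modulo `X ^ N`, this is the residue at `0` of
`h P' / P`. -/
noncomputable def residueValue {A : Type*} [CommRing A] (N : ℕ) (z : A) (v V q h : A[X]) : A :=
  (h * derivative (X * v + C z * q) *
    (∑ i ∈ Finset.range N, (X * v) ^ i * (-(C z * q)) ^ (N - 1 - i)) * V).coeff (N - 1)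

variable {A : Type*} [CommRing A]

/-- The residue formula is polynomial in its data. This allows both reduction modulo `z ^ N` and
specialisation of `z` to a field constant. -/
theorem map_residueValue {B : Type*} [CommRing B] (φ : A →+* B) (N : ℕ) (z : A) (v V q h : A[X]) :
    φ (residueValue N z v V q h) =
      residueValue N (φ z) (v.map φ) (V.map φ) (q.map φ) (h.map φ) := by
  simp only [residueValue, ← Polynomial.coeff_map, Polynomial.map_mul, Polynomial.map_sum,
    Polynomial.map_pow, Polynomial.map_neg, Polynomial.map_add, ← Polynomial.derivative_map,
    Polynomial.map_X, Polynomial.map_C]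

theorem evalRingHom_comp_C (a : A) : (evalRingHom a).comp C = RingHom.id A := by
  ext; simp

theorem eval_residueValue_X (N : ℕ) (a : A) (v V q h : A[X]) :
    (residueValue N X (v.map C) (V.map C) (q.map C) (h.map C)).eval a =
      residueValue N a v V q h := by
  have := map_residueValue (evalRingHom a) N X (v.map C) (V.map C) (q.map C) (h.map C)
  rw [Polynomial.map_map, Polynomial.map_map, Polynomial.map_map, Polynomial.map_map,
    evalRingHom_comp_C, Polynomial.map_id, Polynomial.map_id, Polynomial.map_id, Polynomial.map_id,
    coe_evalRingHom, eval_X] at this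
  exact this

theorem eval_resultant_pencil (f g h : A[X]) (m n : ℕ) (a : A) :
    (resultant (f.map C) (g.map C + C X * h.map C) m n).eval a =
      resultant f (g + C a * h) m n := by
  have := resultant_map_map (f.map C) (g.map C + C X * h.map C) m n (evalRingHom a)
  rw [Polynomial.map_add, Polynomial.map_mul, Polynomial.map_map, Polynomial.map_map,
    Polynomial.map_map, evalRingHom_comp_C, Polynomial.map_id, Polynomial.map_id, Polynomial.map_id,
    Polynomial.map_C, coe_evalRingHom, eval_X] at this
  exact this.symm

theorem isUnit_eval_of_isNilpotent {v : A[X]} (hv : IsUnit (v.coeff 0)) {τ : A}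
    (hτ : IsNilpotent τ) : IsUnit (v.eval τ) := by
  obtain ⟨c, hc⟩ := v.sub_dvd_eval_sub τ 0
  rw [← coeff_zero_eq_eval_zero, sub_zero, sub_eq_iff_eq_add] at hc
  rw [hc]
  exact ((Commute.all _ _).isNilpotent_mul_right hτ).isUnit_add_right_of_commute hv
    (Commute.all _ _)

theorem isCoprime_X_pow_of_isUnit_coeff_zero {u : A[X]} (hu : IsUnit (u.coeff 0)) (N : ℕ) :
    IsCoprime u (X ^ N) := by
  refine IsCoprime.pow_right ?_
  obtain ⟨c, hc⟩ := hu
  refine ⟨C (↑c⁻¹ : A), -(C (↑c⁻¹ : A) * u.divX), ?_⟩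
  nth_rw 1 [← u.divX_mul_X_add]
  rw [← hc, mul_add, ← C_mul, Units.inv_mul, C_1]
  ring

/-- Factor `P = (X - τ) u`, where `u` is a unit near `0`. The logarithmic derivative of `P` then has
a single pole, at `τ`, and the residue of `h P' / P` is `h(τ)`. The proof is the same computation
modulo `X ^ N`. -/
theorem residueValue_eq_eval {N : ℕ} (hN : 1 ≤ N) {z τ : A} (hz : z ^ N = 0) {v V q : A[X]}
    (h : A[X]) (hv : IsUnit (v.coeff 0)) (hV : X ^ N ∣ V * v ^ N - 1) (hτ : IsNilpotent τ)
    (hroot : (X * v + C z * q).eval τ = 0) :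
    residueValue N z v V q h = h.eval τ := by
  -- Since `v(τ)` is a unit, the root equation exhibits `τ` as a multiple of `z`.
  have hτN : τ ^ N = 0 := by
    obtain ⟨c, hc⟩ := isUnit_eval_of_isNilpotent hv hτ
    have h1 : τ = -(z * q.eval τ * ↑c⁻¹) := by
      simp only [eval_add, eval_mul, eval_X, eval_C, ← hc] at hroot
      have : τ * (c * ↑c⁻¹ : A) = -(z * q.eval τ * ↑c⁻¹) := by linear_combination (↑c⁻¹ : A) * hroot
      simpa using this
    rw [h1, neg_pow, mul_pow, mul_pow, hz]
    ring
  set P := X * v + C z * q with hP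
  obtain ⟨u, hu⟩ := dvd_iff_isRoot.2 hroot
  set T := ∑ i ∈ Finset.range N, (X * v) ^ i * (-(C z * q)) ^ (N - 1 - i) with hT
  set S := ∑ i ∈ Finset.range N, (X : A[X]) ^ i * (C τ) ^ (N - 1 - i) with hS
  have hTP : T * P = X ^ N * v ^ N := by
    have := Commute.geom_sum₂_mul (Commute.all (X * v) (-(C z * q))) N
    rw [sub_neg_eq_add, neg_pow, mul_pow (C z), ← C_pow, hz] at this
    rw [hT, hP, this]
    simp [mul_pow]
  have hSX : S * (X - C τ) = X ^ N := by
    rw [hS, Commute.geom_sum₂_mul (Commute.all _ _), ← C_pow, hτN]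
    simp
  obtain ⟨B, hB⟩ := hV
  -- Comparing coefficients of `X` in the two expressions for `P` shows that `u(0)` and `v(0)`
  -- differ by a nilpotent.
  have hu0 : IsUnit (u.coeff 0) := by
    have h1 : P.coeff 1 = v.coeff 0 + z * q.coeff 1 := by simp [hP, coeff_X_mul]
    have h2 : P.coeff 1 = u.coeff 0 - τ * u.coeff 1 := by
      rw [hu, sub_mul, coeff_sub, coeff_C_mul]
      simp [coeff_X_mul]
    have h3 : u.coeff 0 = (z * q.coeff 1 + τ * u.coeff 1) + v.coeff 0 := by
      linear_combination h1 - h2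
    rw [h3]
    refine IsNilpotent.isUnit_add_right_of_commute ?_ hv (Commute.all _ _)
    exact (Commute.all _ _).isNilpotent_add
      ((Commute.all _ _).isNilpotent_mul_right ⟨N, hz⟩) ((Commute.all _ _).isNilpotent_mul_right hτ)
  have hreg : IsRegular (X - C τ) := (monic_X_sub_C τ).isRegular
  have hTVu : T * V * u = S * (1 + X ^ N * B) := by
    refine hreg.right ?_
    change T * V * u * (X - C τ) = S * (1 + X ^ N * B) * (X - C τ)
    linear_combination V * hTP + X ^ N * hB - (1 + X ^ N * B) * hSX - T * V * hu
  -- Multiplied by `u`, the right side is visibly divisible by `X ^ N`; `u` is coprime to `X ^ N`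
  -- and cancels.
  obtain ⟨D, hD⟩ : X ^ N ∣ (X - C τ) * T * V := by
    refine (isCoprime_X_pow_of_isUnit_coeff_zero hu0 N).symm.dvd_of_dvd_mul_left (y := u) ?_
    refine ⟨1 + X ^ N * B, ?_⟩
    linear_combination V * hTP + X ^ N * hB - T * V * hu
  obtain ⟨h1, hh1⟩ : X - C τ ∣ h - C (h.eval τ) := by
    rw [dvd_iff_isRoot]; simp
  -- Write `P' = u + (X - τ) u'`. The second term dies modulo `X ^ N` by `hD`; in the first, `h` may
  -- be replaced by `h(τ)` because `S (X - τ) = X ^ N`.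
  have hmain : h * derivative P * T * V =
      C (h.eval τ) * S + X ^ N * (h1 + h * S * B + h * derivative u * D) := by
    have hder : derivative P = u + (X - C τ) * derivative u := by
      rw [hu, derivative_mul]; simp
    rw [hder]
    linear_combination h * hTVu + h * derivative u * hD + S * hh1 + h1 * hSX
  have hScoeff : S.coeff (N - 1) = 1 := by
    simp only [hS, finsetSum_coeff, ← C_pow, coeff_mul_C, coeff_X_pow]
    rw [Finset.sum_eq_single (N - 1)]
    · simp
    · intro b _ hb; simp [hb.symm]
    · intro hb; exact absurd (Finset.mem_range.2 (by omega)) hb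
  have : residueValue N z v V q h = (h * derivative P * T * V).coeff (N - 1) := rfl
  rw [this, hmain, coeff_add, coeff_C_mul, hScoeff, coeff_X_pow_mul', if_neg (by omega)]
  ring

end Residue

/-! ### Resultants by deformation from a split polynomial. -/

section Homotopy

variable {A : Type*} [CommRing A]

/-- A homotopy from a product of linear factors with simple roots to `f`, followed up to order `N`,
expresses resultants by residues. -/
theorem resultant_homotopy_eq_prod {d n N : ℕ} (hN : 1 ≤ N) {z : A} (hz : z ^ N = 0)
    (α : Fin d → A) {f f₀ g : A[X]} (hf : f.Monic) (hfd : f.natDegree = d)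
    (hf₀ : f₀ = ∏ i, (X - C (α i))) (hg : g.natDegree ≤ n)
    (hα : ∀ i j, i ≠ j → IsUnit (α i - α j)) (v V : Fin d → A[X])
    (hv : ∀ i, X * v i = f₀.comp (X + C (α i))) (hv0 : ∀ i, IsUnit ((v i).coeff 0))
    (hV : ∀ i, X ^ N ∣ V i * v i ^ N - 1) :
    resultant (f₀ + C z * (f - f₀)) g d n =
      ∏ i, residueValue N z (v i) (V i) ((f - f₀).comp (X + C (α i))) (g.comp (X + C (α i))) := by
  nontriviality A
  have hznil : IsNilpotent z := ⟨N, hz⟩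
  have hf₀m : f₀.Monic := hf₀ ▸ monic_prod_of_monic _ _ fun i _ => monic_X_sub_C _
  have hf₀d : f₀.natDegree = d := by
    rw [hf₀, natDegree_prod_of_monic _ _ fun i _ => monic_X_sub_C _]; simp
  have hlt : (C z * (f - f₀)).degree < f₀.degree := by
    rw [C_mul']
    refine (degree_smul_le _ _).trans_lt ?_
    have : f.degree = f₀.degree := by
      rw [degree_eq_natDegree hf.ne_zero, degree_eq_natDegree hf₀m.ne_zero, hfd, hf₀d]
    rw [← this]
    exact degree_sub_lt_left this hf.ne_zero (by rw [hf.leadingCoeff, hf₀m.leadingCoeff])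
  set F := f₀ + C z * (f - f₀) with hF
  have hFm : F.Monic := hf₀m.add_of_left hlt
  have hFd : F.natDegree = d := by
    rw [hF, natDegree_add_eq_left_of_degree_lt hlt, hf₀d]
  have hshift : ∀ i, F.comp (X + C (α i)) =
      X * v i + C z * (f - f₀).comp (X + C (α i)) := by
    intro i
    rw [hv, hF]; simp
  -- Newton–Hensel lifting from `0`: the value there is a multiple of `z`, and the derivative is a
  -- unit up to a nilpotent.
  have hex : ∀ i, ∃ τ, IsNilpotent τ ∧ (F.comp (X + C (α i))).eval τ = 0 := by
    intro i
    obtain ⟨r, ⟨hr1, hr2⟩, -⟩ := existsUnique_nilpotent_sub_and_aeval_eq_zero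
      (P := F.comp (X + C (α i))) (x := (0 : A)) (by
        rw [hshift, coe_aeval_eq_eval]
        simpa using (Commute.all _ _).isNilpotent_mul_right hznil) (by
        rw [hshift, coe_aeval_eq_eval]
        simp only [derivative_add, derivative_mul, derivative_X, derivative_C, eval_add, eval_mul,
          eval_X, eval_C, one_mul, zero_mul, zero_add, add_zero, ← coeff_zero_eq_eval_zero (v i)]
        rw [add_comm]
        exact ((Commute.all _ _).isNilpotent_mul_right hznil).isUnit_add_right_of_commute (hv0 i)
          (Commute.all _ _))
    refine ⟨r, by simpa using hr1.neg, by simpa [coe_aeval_eq_eval] using hr2⟩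
  choose τ hτ hroot using hex
  -- The lifted roots still differ by units, so the linear factors are coprime and their product
  -- divides `F`; both are monic of degree `d`.
  have hFprod : F = ∏ i, (X - C (τ i + α i)) := by
    refine eq_of_monic_of_dvd_of_natDegree_le
      (monic_prod_of_monic _ _ fun i _ => monic_X_sub_C _) hFm ?_ ?_
    · refine Finset.prod_dvd_of_coprime (fun i _ j _ hij => ?_) fun i _ => ?_
      · refine isCoprime_X_sub_C_of_isUnit_sub ?_
        have : τ i + α i - (τ j + α j) = (τ i - τ j) + (α i - α j) := by ring
        rw [this]
        exact ((Commute.all _ _).isNilpotent_sub (hτ i) (hτ j)).isUnit_add_right_of_commute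
          (hα i j hij) (Commute.all _ _)
      · rw [dvd_iff_isRoot]
        simpa using hroot i
    · rw [hFd, natDegree_prod_of_monic _ _ fun i _ => monic_X_sub_C _]
      simp only [natDegree_X_sub_C]
      simp
  have hres := resultant_prod_left Finset.univ (fun i => X - C (τ i + α i)) g n
    (by simp only [(monic_X_sub_C _).leadingCoeff]; simp) hg
  rw [← hFprod, hFd] at hres
  rw [hres]
  refine Finset.prod_congr rfl fun i _ => ?_
  rw [natDegree_X_sub_C, resultant_X_sub_C_left _ _ _ hg,
    residueValue_eq_eval hN hz _ (hv0 i) (hV i) (hτ i) (by rw [← hshift]; exact hroot i)]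
  simp

/-- The Sylvester matrix has size `m + n` and is affine linear in the parameter. -/
theorem natDegree_resultant_pencil_le (f₁ f₂ g₁ g₂ : A[X]) (m n : ℕ) :
    (resultant (f₁.map C + C X * f₂.map C) (g₁.map C + C X * g₂.map C) m n).natDegree ≤
      m + n := by
  have : sylvester (f₁.map C + C X * f₂.map C) (g₁.map C + C X * g₂.map C) m n =
      (X : A[X]) • (sylvester f₂ g₂ m n).map C + (sylvester f₁ g₁ m n).map C := by
    ext1 i j
    induction j using Fin.addCases <;> simp only [sylvester, Matrix.of_apply, Fin.addCases_left,
      Fin.addCases_right, Matrix.add_apply, Matrix.smul_apply, Matrix.map_apply] <;>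
      split_ifs <;> simp [add_comm]
  rw [resultant, this]
  simpa using natDegree_det_X_add_C_le (sylvester f₂ g₂ m n) (sylvester f₁ g₁ m n)

/-- The resultant as a sum of coefficients of a product of residues. -/
theorem resultant_eq_sum_coeff_prod {d n N : ℕ} (hN : d + n < N)
    (α : Fin d → A) {f f₀ g : A[X]} (hf : f.Monic) (hfd : f.natDegree = d)
    (hf₀ : f₀ = ∏ i, (X - C (α i))) (hg : g.natDegree ≤ n)
    (hα : ∀ i j, i ≠ j → IsUnit (α i - α j)) (v V : Fin d → A[X])
    (hv : ∀ i, X * v i = f₀.comp (X + C (α i))) (hv0 : ∀ i, IsUnit ((v i).coeff 0))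
    (hV : ∀ i, X ^ N ∣ V i * v i ^ N - 1) :
    resultant f g d n = ∑ j ∈ Finset.range N, (∏ i, residueValue N (X : A[X]) ((v i).map C)
      ((V i).map C) (((f - f₀).comp (X + C (α i))).map C)
      ((g.comp (X + C (α i))).map C)).coeff j := by
  nontriviality A
  set G : A[X] := ∏ i, residueValue N (X : A[X]) ((v i).map C)
      ((V i).map C) (((f - f₀).comp (X + C (α i))).map C) ((g.comp (X + C (α i))).map C) with hG
  set R : A[X] := resultant (f₀.map C + C X * (f - f₀).map C) (g.map C) d n with hR
  have hRd : R.natDegree ≤ d + n := by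
    have := natDegree_resultant_pencil_le f₀ (f - f₀) g 0 d n
    rwa [Polynomial.map_zero, mul_zero, add_zero] at this
  have hR1 : R.eval 1 = resultant f g d n := by
    rw [hR, ← coe_evalRingHom, ← resultant_map_map]
    congr 1
    · simp [Polynomial.map_map, evalRingHom_comp_C]
    · simp [Polynomial.map_map, evalRingHom_comp_C]
  -- The inner variable plays the role of `z`: in the quotient by `X ^ N` it is nilpotent and the
  -- homotopy formula applies.
  have hdvd : X ^ N ∣ R - G := by
    rw [← Ideal.mem_span_singleton, ← Ideal.Quotient.eq]
    set π := Ideal.Quotient.mk (Ideal.span {(X : A[X]) ^ N})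
    have hz : π X ^ N = 0 := by
      rw [← map_pow, Ideal.Quotient.eq_zero_iff_mem]
      exact Ideal.mem_span_singleton_self _
    have hcomp : ∀ (p : A[X]) i, (p.map (π.comp C)).comp (X + C (π (C (α i)))) =
        (p.comp (X + C (α i))).map (π.comp C) := by
      intro p i; simp [Polynomial.map_comp]
    have h2 := resultant_homotopy_eq_prod (n := n) (by omega) hz (fun i => π (C (α i)))
      (f := f.map (π.comp C)) (f₀ := f₀.map (π.comp C)) (g := g.map (π.comp C))
      (hf.map _)
      (by
        have : Nontrivial (A[X] ⧸ Ideal.span {(X : A[X]) ^ N}) := by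
          rw [Ideal.Quotient.nontrivial_iff, Ne, Ideal.span_singleton_eq_top]
          intro hu
          have := (isUnit_pow_iff (by omega)).1 hu
          exact not_isUnit_X this
        rw [hf.natDegree_map, hfd])
      (by simp [hf₀, Polynomial.map_prod]) (natDegree_map_le.trans hg)
      (fun i j hij => by
        rw [← map_sub, ← C_sub]
        exact (hα i j hij).map (π.comp C))
      (fun i => (v i).map (π.comp C)) (fun i => (V i).map (π.comp C))
      (fun i => by rw [hcomp, ← hv]; simp)
      (fun i => by rw [coeff_map]; exact (hv0 i).map _)
      (fun i => by simpa using Polynomial.map_dvd (π.comp C) (hV i))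
    rw [hR, hG, map_prod]
    refine (resultant_map_map _ _ d n π).symm.trans (Eq.trans ?_ (h2.trans (Finset.prod_congr rfl fun i _ => ?_)))
    · congr 1 <;> simp [Polynomial.map_map]
    · rw [map_residueValue, ← Polynomial.map_sub, hcomp, hcomp]
      simp only [Polynomial.map_map]
  rw [← hR1, eval_eq_sum_range' (n := N) (by omega)]
  refine Finset.sum_congr rfl fun j hj => ?_
  rw [one_pow, mul_one, ← sub_eq_zero, ← coeff_sub]
  exact X_pow_dvd_iff.1 hdvd j (Finset.mem_range.1 hj)

end Homotopy

/-! ### Degree in the deformation parameter. -/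

section Degree

variable {A : Type*} [CommRing A]

/-- All coefficients of `Q` have degree at most `k`. -/
def CoeffDegreeLE (k : ℕ) (Q : A[X][X]) : Prop :=
  ∀ j, (Q.coeff j).natDegree ≤ k

namespace CoeffDegreeLE

theorem mono {k k' : ℕ} {P : A[X][X]} (hP : CoeffDegreeLE k P) (h : k ≤ k') :
    CoeffDegreeLE k' P :=
  fun j => (hP j).trans h

theorem add {k : ℕ} {P Q : A[X][X]} (hP : CoeffDegreeLE k P) (hQ : CoeffDegreeLE k Q) :
    CoeffDegreeLE k (P + Q) := fun j => by
  rw [coeff_add]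
  exact natDegree_add_le_of_degree_le (hP j) (hQ j)

theorem neg {k : ℕ} {P : A[X][X]} (hP : CoeffDegreeLE k P) : CoeffDegreeLE k (-P) := fun j => by
  rw [coeff_neg, natDegree_neg]
  exact hP j

theorem mul {k l : ℕ} {P Q : A[X][X]} (hP : CoeffDegreeLE k P) (hQ : CoeffDegreeLE l Q) :
    CoeffDegreeLE (k + l) (P * Q) := fun j => by
  rw [coeff_mul]
  exact natDegree_sum_le_of_forall_le _ _ fun x _ => natDegree_mul_le_of_le (hP x.1) (hQ x.2)

theorem sum {k : ℕ} {ι : Type*} {s : Finset ι} {P : ι → A[X][X]}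
    (hP : ∀ i ∈ s, CoeffDegreeLE k (P i)) : CoeffDegreeLE k (∑ i ∈ s, P i) := fun j => by
  rw [finsetSum_coeff]
  exact natDegree_sum_le_of_forall_le _ _ fun i hi => hP i hi j

theorem map_C (p : A[X]) : CoeffDegreeLE 0 (p.map C) := fun j => by
  rw [coeff_map, natDegree_C]

theorem pow {k : ℕ} {P : A[X][X]} (hP : CoeffDegreeLE k P) (e : ℕ) :
    CoeffDegreeLE (e * k) (P ^ e) := by
  induction e with
  | zero => simpa using map_C (1 : A[X])
  | succ e ih => rw [pow_succ, Nat.succ_mul]; exact ih.mul hP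

theorem derivative {k : ℕ} {P : A[X][X]} (hP : CoeffDegreeLE k P) :
    CoeffDegreeLE k (derivative P) := fun j => by
  rw [coeff_derivative]
  refine (natDegree_mul_le_of_le (hP _) (n := 0) ?_).trans (by simp)
  exact_mod_cast (natDegree_natCast (R := A) (j + 1)).le

theorem C_X_mul (p : A[X]) : CoeffDegreeLE 1 (C X * p.map C) := fun j => by
  rw [coeff_C_mul, coeff_map]
  exact (natDegree_mul_C_le _ _).trans natDegree_X_le

end CoeffDegreeLE

/-- `P'` contributes degree `1` in `z` and the geometric sum `N - 1`. The bound makes interpolation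
in `z` possible. -/
theorem natDegree_residueValue_X_le (N : ℕ) (v V q h : A[X]) :
    (residueValue N (X : A[X]) (v.map C) (V.map C) (q.map C) (h.map C)).natDegree ≤ N := by
  rcases Nat.eq_zero_or_pos N with rfl | hN
  · simp [residueValue]
  have hXv : CoeffDegreeLE 0 (X * v.map C) := by
    rw [show X * v.map C = (X * v).map C by rw [Polynomial.map_mul, Polynomial.map_X]]
    exact CoeffDegreeLE.map_C (X * v)
  have hq := CoeffDegreeLE.C_X_mul q
  have hP' := ((hXv.mono zero_le_one).add hq).derivative
  have hT : CoeffDegreeLE (N - 1) (∑ i ∈ Finset.range N,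
      (X * v.map C) ^ i * (-(C X * q.map C)) ^ (N - 1 - i)) :=
    CoeffDegreeLE.sum fun i _ => ((hXv.pow i).mul (hq.neg.pow _)).mono (by omega)
  refine (((((CoeffDegreeLE.map_C h).mul hP').mul hT).mul (CoeffDegreeLE.map_C V)) _).trans ?_
  omega

end Degree

/-- Polynomials `v`, `V` as needed for `residueValue` at a simple root. -/
theorem exists_residue_data {F : Type*} [Field F] {d : ℕ} (α : Fin d ↪ F) (N : ℕ) (i : Fin d) :
    ∃ v V : F[X], X * v = (∏ j, (X - C (α j))).comp (X + C (α i)) ∧ v.coeff 0 ≠ 0 ∧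
      X ^ N ∣ V * v ^ N - 1 ∧ V.natDegree ≤ N := by
  set v : F[X] := ∏ j ∈ Finset.univ.erase i, (X + C (α i) - C (α j)) with hv
  have hv0 : v.coeff 0 ≠ 0 := by
    rw [coeff_zero_eq_eval_zero, hv, eval_prod, Finset.prod_ne_zero_iff]
    intro j hj
    simpa [sub_eq_zero] using fun h => (Finset.ne_of_mem_erase hj).symm h
  obtain ⟨a, b, hab⟩ := (isCoprime_X_pow_of_isUnit_coeff_zero hv0.isUnit N).pow_left (m := N)
  have hm : (X ^ N : F[X]).Monic := monic_X_pow N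
  -- Reducing the inverse modulo `X ^ N` bounds its degree.
  refine ⟨v, a %ₘ X ^ N, ?_, hv0, ?_, ?_⟩
  · rw [prod_comp, ← Finset.mul_prod_erase _ _ (Finset.mem_univ i)]
    simp [hv]
  · refine ⟨-(b + (a /ₘ X ^ N) * v ^ N), ?_⟩
    have := modByMonic_add_div a (X ^ N : F[X])
    linear_combination hab + v ^ N * this
  · exact (natDegree_modByMonic_le a hm).trans (by simp)

/-! ### Constant-depth circuits for resultants. -/

namespace CircuitLevel

variable {F : Type u} {V : Type v} [Field F] {M Δ k : ℕ}

/-- `v` and `W` have coefficients in `F`, so their values at constants are constants. Only `q`, `h`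
and `P'` need circuits, and interpolation in `X` gives the coefficient. Here `b` is any constant:
the condition `z ^ N = 0` matters for the meaning of the formula, not for its evaluation. -/
theorem residueValue (hM : 2 ≤ M) (e : Fin M ↪ F) {N d n : ℕ} (hN : N ≤ M) (b : F) {v W : F[X]}
    {q h : (MvPolynomial V F)[X]} (hv : (X * v).natDegree ≤ d) (hW : W.natDegree ≤ N)
    (hq : q.natDegree ≤ d) (hh : h.natDegree ≤ n) (hdeg : n + d + (N - 1) * d + N < M)
    (hq' : ∀ c : F, CircuitLevel M Δ k (q.eval (MvPolynomial.C c)))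
    (hh' : ∀ c : F, CircuitLevel M Δ k (h.eval (MvPolynomial.C c)))
    (hP' : ∀ c : F, CircuitLevel M Δ k ((derivative (X * v.map MvPolynomial.C +
      C (MvPolynomial.C b) * q)).eval (MvPolynomial.C c))) :
    CircuitLevel M Δ (k + 16) (_root_.residueValue N (MvPolynomial.C b) (v.map MvPolynomial.C)
      (W.map MvPolynomial.C) q h) := by
  have hXv : (X * v.map MvPolynomial.C : (MvPolynomial V F)[X]) =
      (X * v).map MvPolynomial.C := by
    rw [Polynomial.map_mul, Polynomial.map_X]
  have hdXv : (X * v.map MvPolynomial.C : (MvPolynomial V F)[X]).natDegree ≤ d := by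
    rw [hXv]; exact natDegree_map_le.trans hv
  have hdq : (C (MvPolynomial.C b) * q).natDegree ≤ d := (natDegree_C_mul_le _ _).trans hq
  refine coeff_of_eval (k := k + 12) hM ?_ e (fun c => ?_) (N - 1)
  · refine lt_of_le_of_lt (natDegree_mul_le_of_le (natDegree_mul_le_of_le
      (natDegree_mul_le_of_le hh (natDegree_derivative_le _ |>.trans (Nat.sub_le _ _) |>.trans
        (natDegree_add_le_of_degree_le hdXv hdq)))
      (natDegree_sum_le_of_forall_le (n := (N - 1) * d) _ _ fun i hi => ?_))
      (natDegree_map_le.trans hW)) hdeg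
    refine (natDegree_mul_le_of_le (natDegree_pow_le_of_le i hdXv)
      (natDegree_pow_le_of_le (N - 1 - i) ((natDegree_neg _).trans_le hdq))).trans ?_
    have := Finset.mem_range.1 hi
    rw [← add_mul]
    exact Nat.mul_le_mul_right _ (by omega)
  · rw [eval_mul, eval_mul, eval_mul, eval_finsetSum]
    refine mul (k := k + 10) hM (mul (k := k + 8) hM (mul (k := k) hM (hh' c) (hP' c)
      |>.mono hM (by omega)) ?_) ?_
    · refine sum (k := k + 6) hM _ (by simpa using hN) fun i hi => ?_
      rw [hXv, eval_mul, eval_pow, eval_pow, eval_neg, eval_mul, eval_C, eval_map, eval₂_at_apply,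
        ← map_pow, ← neg_mul, ← map_neg]
      refine mul (k := k + 4) hM (const hM _ _) (pow (k := k + 2) hM (mul hM (const hM _ _) (hq' c)) ?_)
      omega
    · rw [eval_map, eval₂_at_apply]
      exact const hM _ _

theorem resultant (hM : 2 ≤ M) (e : Fin M ↪ F) {d n : ℕ} (hdeg : (d + n) * (d + 2) + 1 < M)
    {f g : (MvPolynomial V F)[X]} (hf : f.Monic) (hfd : f.natDegree = d) (hg : g.natDegree ≤ n)
    (hf' : ∀ j, CircuitLevel M Δ k (f.coeff j)) (hg' : ∀ j, CircuitLevel M Δ k (g.coeff j)) :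
    CircuitLevel M Δ (k + 36) (Polynomial.resultant f g d n) := by
  have hd : d + n + 1 < M := by nlinarith
  set N := d + n + 1 with hN
  have hdN : d * N < M := by rw [hN]; nlinarith
  let α : Fin d ↪ F := (Fin.castLEEmb (by omega)).trans e
  choose v W hv hv0 hW hWd using exists_residue_data α N
  set φ : F →+* MvPolynomial V F := MvPolynomial.C with hφ
  set f₀ : F[X] := ∏ i, (X - C (α i)) with hf₀
  have hf₀d : f₀.natDegree = d := by
    rw [hf₀, natDegree_prod_of_monic _ _ fun i _ => monic_X_sub_C _]
    simp
  have hcomp : ∀ i, (f₀.map φ).comp (X + C (φ (α i))) = X * (v i).map φ := by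
    intro i
    have := congrArg (Polynomial.map φ) (hv i)
    rw [Polynomial.map_mul, Polynomial.map_X] at this
    rw [this, Polynomial.map_comp]
    simp
  have hvd : ∀ i, (X * v i).natDegree ≤ d := by
    intro i
    rw [hv, natDegree_comp, natDegree_X_add_C, hf₀d, mul_one]
  have hcompd : ∀ (p : (MvPolynomial V F)[X]) (a : F),
      (p.comp (X + C (φ a))).natDegree = p.natDegree := by
    intro p a
    rw [natDegree_comp, natDegree_X_add_C, mul_one]
  have hsub : ∀ j, CircuitLevel M Δ (k + 2) ((f - f₀.map φ).coeff j) := by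
    intro j
    rw [coeff_sub, coeff_map, sub_eq_add_neg, ← map_neg]
    exact add hM (hf' j) (const hM _ _)
  have hsubd : (f - f₀.map φ).natDegree ≤ d :=
    (natDegree_sub_le_of_le hfd.le (natDegree_map_le.trans hf₀d.le)).trans (by simp)
  rw [resultant_eq_sum_coeff_prod (N := N) (by omega) (fun i => φ (α i)) hf hfd
    (f₀ := f₀.map φ) (by simp [hf₀, Polynomial.map_prod]) hg
    (fun i j hij => by
      rw [← map_sub]
      exact (sub_ne_zero.2 (α.injective.ne hij)).isUnit.map φ)
    (fun i => (v i).map φ) (fun i => (W i).map φ) (fun i => (hcomp i).symm)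
    (fun i => by rw [coeff_map]; exact (hv0 i).isUnit.map φ)
    (fun i => by simpa using Polynomial.map_dvd φ (hW i))]
  refine sum (k := k + 34) hM _ (by rw [Finset.card_range]; omega) fun j _ => ?_
  refine coeff_of_eval (k := k + 30) hM ?_ e (fun b => ?_) j
  · refine lt_of_le_of_lt (natDegree_prod_le _ _) (lt_of_le_of_lt
      (Finset.sum_le_card_nsmul _ _ N fun i _ => natDegree_residueValue_X_le _ _ _ _ _) ?_)
    simpa using hdN
  rw [eval_prod]
  refine prod (k := k + 28) hM _ (by rw [Finset.card_univ, Fintype.card_fin]; omega)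
    fun i _ => ?_
  rw [eval_residueValue_X]
  refine residueValue (k := k + 12) hM e (by omega) b (hvd i) (hWd i)
    ((hcompd _ _).trans_le hsubd) ((hcompd _ _).trans_le hg) ?_ (fun c => ?_) (fun c => ?_)
    (fun c => ?_)
  -- With `N = d + n + 1` the degree bound is exactly `(d + n) * (d + 2) + 1`.
  · rw [hN, Nat.add_sub_cancel]; nlinarith
  · rw [eval_comp, eval_add, eval_X, eval_C, ← map_add]
    exact (eval hM (by omega) hsub _).mono hM (by omega)
  · rw [eval_comp, eval_add, eval_X, eval_C, ← map_add]
    exact (eval hM (by omega) hg' _).mono hM (by omega)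
  -- `P` is a shift of `f₀ + b (f - f₀)`, so `P'` at `c` is the derivative of the latter at `c + α
  -- i`, obtained from known coefficients.
  · have hshift : X * (v i).map φ + C (φ b) * (f - f₀.map φ).comp (X + C (φ (α i))) =
        (f₀.map φ + C (φ b) * (f - f₀.map φ)).comp (X + C (φ (α i))) := by
      rw [← hcomp]; simp
    have hd' : (f₀.map φ + C (φ b) * (f - f₀.map φ)).natDegree ≤ d :=
      natDegree_add_le_of_degree_le (natDegree_map_le.trans hf₀d.le)
        ((natDegree_C_mul_le _ _).trans hsubd)
    rw [hshift, derivative_comp, derivative_add, derivative_X, derivative_C, add_zero, one_mul,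
      eval_comp, eval_add, eval_X, eval_C, ← map_add]
    refine eval (k := k + 8) hM ?_ (fun j => ?_) _
    · exact lt_of_le_of_lt ((natDegree_derivative_le _).trans (Nat.sub_le _ _)) (by omega)
    · rw [coeff_derivative, coeff_add, coeff_C_mul, coeff_map,
        show ((j : MvPolynomial V F) + 1) = φ (j + 1) by simp]
      exact mul (k := k + 6) hM (add (k := k + 4) hM (const hM _ _) (mul (k := k + 2) hM (const hM _ _)
        (hsub _))) (const hM _ _)

/-- Circuits for the coefficients, in a parameter `t`, of the resultant of `f` and `g + t h`. -/
theorem coeff_resultant_pencil (hM : 2 ≤ M) (e : Fin M ↪ F) {d n : ℕ}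
    (hdeg : (d + n) * (d + 2) + 1 < M)
    {f g h : (MvPolynomial V F)[X]} (hf : f.Monic) (hfd : f.natDegree = d)
    (hg : g.natDegree ≤ n) (hh : h.natDegree ≤ n)
    (hf' : ∀ c : F, CircuitLevel M Δ k (f.eval (MvPolynomial.C c)))
    (hg' : ∀ c : F, CircuitLevel M Δ k (g.eval (MvPolynomial.C c)))
    (hh' : ∀ c : F, CircuitLevel M Δ k (h.eval (MvPolynomial.C c))) (j : ℕ) :
    CircuitLevel M Δ (k + 48)
      ((Polynomial.resultant (f.map C) (g.map C + C X * h.map C) d n).coeff j) := by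
  have hd : d + n + 1 < M := by nlinarith
  refine coeff_of_eval (k := k + 44) hM ?_ e (fun b => ?_) j
  · have := natDegree_resultant_pencil_le f 0 g h d n
    rw [Polynomial.map_zero, mul_zero, add_zero] at this
    omega
  rw [eval_resultant_pencil]
  have hd' : (g + C (MvPolynomial.C b) * h).natDegree ≤ n :=
    natDegree_add_le_of_degree_le hg ((natDegree_C_mul_le _ _).trans hh)
  refine resultant (k := k + 8) hM e hdeg hf hfd hd' (fun i => ?_) (fun i => ?_)
  · exact (coeff_of_eval hM (by omega) e hf' i).mono hM (by omega)
  · refine coeff_of_eval (k := k + 4) hM (by omega) e (fun c => ?_) i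
    rw [eval_add, eval_mul, eval_C]
    exact add (k := k + 2) hM ((hg' c).mono hM (by omega)) (mul hM (const hM _ _) (hh' c))

end CircuitLevel

/-! ### Symmetric functions of roots as coefficients of a resultant. -/

section Roots

variable {F : Type u} [Field F] {n : ℕ}

theorem toClosure_injective : Function.Injective (toClosure : MvPolynomial (Fin n) F → _) := by
  unfold toClosure
  rw [IsScalarTower.algebraMap_eq (MvPolynomial (Fin n) F) (FractionRing (MvPolynomial (Fin n) F))
    (RatFunClosure F n)]
  exact (algebraMap (FractionRing (MvPolynomial (Fin n) F)) (RatFunClosure F n)).injective.comp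
    (IsFractionRing.injective _ _)

theorem card_yRoots {f : MvPolynomial (Option (Fin n)) F} (hf : (inY f).Monic) :
    (yRoots f).card = (inY f).natDegree := by
  rw [yRoots, aroots_def, ← (IsAlgClosed.splits _).natDegree_eq_card_roots, hf.natDegree_map]

theorem toClosure_resultant {f : MvPolynomial (Option (Fin n)) F} (hf : (inY f).Monic)
    (p : (MvPolynomial (Fin n) F)[X]) {m : ℕ} (hp : p.natDegree ≤ m) :
    toClosure (resultant (inY f) p (inY f).natDegree m) =
      ((yRoots f).map fun σ => aeval σ p).prod := by
  rw [toClosure, ← resultant_map_map]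
  have := resultant_eq_prod_eval ((inY f).map (algebraMap _ (RatFunClosure F n)))
    (p.map (algebraMap _ (RatFunClosure F n))) m (natDegree_map_le.trans hp) (IsAlgClosed.splits _)
  rw [hf.natDegree_map, (hf.map _).leadingCoeff, one_pow, one_mul] at this
  rw [this, yRoots, aroots_def]
  simp only [eval_map_algebraMap]

/-- The resultant of `f` and `g + t h` in `y`, as a polynomial in `t`. -/
noncomputable def pencilResultant (f g h : MvPolynomial (Option (Fin n)) F) (m : ℕ) :
    (MvPolynomial (Fin n) F)[X] :=
  resultant ((inY f).map C) ((inY g).map C + C X * (inY h).map C) (inY f).natDegree m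

theorem map_pencilResultant {f g h : MvPolynomial (Option (Fin n)) F} (hf : (inY f).Monic) {m : ℕ}
    (hg : (inY g).natDegree ≤ m) (hh : (inY h).natDegree ≤ m) :
    (pencilResultant f g h m).map (algebraMap _ (RatFunClosure F n)) =
      ((yRoots f).map fun σ => C (evalY g σ) + X * C (evalY h σ)).prod := by
  -- The closure is infinite, so it suffices to compare values at each `t`, where the resultant is a
  -- product over the roots of `f`.
  refine Polynomial.funext fun t => ?_
  have hid : (evalRingHom t).comp ((mapRingHom (algebraMap (MvPolynomial (Fin n) F)
      (RatFunClosure F n))).comp C) = algebraMap _ _ := by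
    ext <;> simp
  have h1 : ((pencilResultant f g h m).map (algebraMap _ (RatFunClosure F n))).eval t =
      resultant ((inY f).map (algebraMap _ (RatFunClosure F n)))
        ((inY g).map (algebraMap _ (RatFunClosure F n)) +
          C t * (inY h).map (algebraMap _ (RatFunClosure F n))) (inY f).natDegree m := by
    rw [← coe_evalRingHom, ← coe_mapRingHom, ← RingHom.comp_apply, pencilResultant,
      ← resultant_map_map, Polynomial.map_add, Polynomial.map_mul, Polynomial.map_map,
      Polynomial.map_map, Polynomial.map_map, Polynomial.map_C, RingHom.comp_assoc, hid]
    rw [RingHom.comp_apply, coe_mapRingHom, Polynomial.map_X, coe_evalRingHom, eval_X]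
  have h2 := resultant_eq_prod_eval ((inY f).map (algebraMap _ (RatFunClosure F n)))
    ((inY g).map (algebraMap _ (RatFunClosure F n)) +
          C t * (inY h).map (algebraMap _ (RatFunClosure F n))) m
    (natDegree_add_le_of_degree_le (natDegree_map_le.trans hg)
      ((natDegree_C_mul_le _ _).trans (natDegree_map_le.trans hh))) (IsAlgClosed.splits _)
  rw [hf.natDegree_map, (hf.map _).leadingCoeff, one_pow, one_mul] at h2
  rw [h1, h2, eval_multiset_prod, Multiset.map_map, yRoots, aroots_def]
  simp [evalY, eval_map_algebraMap, mul_comm t]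

/-- A form of Gauss's lemma: `σ` is integral over the integrally closed ring `F[x]`, so its minimal
polynomial there divides every polynomial vanishing at `σ`. A common root would give `f` and `h` a
common non-unit factor. -/
theorem evalY_ne_zero {f h : MvPolynomial (Option (Fin n)) F} (hf : (inY f).Monic)
    (hfh : IsRelPrime f h) {σ : RatFunClosure F n} (hσ : σ ∈ yRoots f) : evalY h σ ≠ 0 := by
  intro hh
  have hinj : Function.Injective (algebraMap (MvPolynomial (Fin n) F) (RatFunClosure F n)) :=
    toClosure_injective
  have hfσ : aeval σ (inY f) = 0 := (mem_aroots'.1 hσ).2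
  have hint : IsIntegral (MvPolynomial (Fin n) F) σ := ⟨inY f, hf, hfσ⟩
  have : Module.IsTorsionFree (MvPolynomial (Fin n) F) (RatFunClosure F n) := by
    exact Module.isTorsionFree_iff_algebraMap_injective.2 hinj
  have h1 := minpoly.isIntegrallyClosed_dvd hint hfσ
  have h2 := minpoly.isIntegrallyClosed_dvd hint hh
  have h3 : IsUnit (minpoly (MvPolynomial (Fin n) F) σ) := by
    let ε := MvPolynomial.optionEquivLeft F (Fin n)
    have h4 : IsUnit (ε.symm (minpoly (MvPolynomial (Fin n) F) σ)) := by
      refine hfh ?_ ?_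
      · simpa [inY, ε] using map_dvd ε.symm h1
      · simpa [inY, ε] using map_dvd ε.symm h2
    simpa using h4.map ε
  exact minpoly.not_isUnit _ _ h3

/-- Pulling `h(σ)` out of each factor `g(σ) + t h(σ)` leaves the product of the `t + g(σ) / h(σ)`,
whose coefficients are the elementary symmetric functions. -/
theorem esymm_div_eq {f g h : MvPolynomial (Option (Fin n)) F} (hf : (inY f).Monic) {m r : ℕ}
    (hg : (inY g).natDegree ≤ m) (hh : (inY h).natDegree ≤ m) (hr : r ≤ (inY f).natDegree)
    (h0 : ∀ σ ∈ yRoots f, evalY h σ ≠ 0) :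
    ((yRoots f).map fun σ => evalY g σ / evalY h σ).esymm r =
      toClosure ((pencilResultant f g h m).coeff ((inY f).natDegree - r)) /
        toClosure (resultant (inY f) (inY h) (inY f).natDegree m) := by
  have hB := toClosure_resultant hf (inY h) hh
  have hB0 : toClosure (resultant (inY f) (inY h) (inY f).natDegree m) ≠ 0 := by
    rw [hB]
    refine Multiset.prod_ne_zero fun hmem => ?_
    obtain ⟨σ, hσ, hσ0⟩ := Multiset.mem_map.1 hmem
    exact h0 σ hσ hσ0
  have hA : (pencilResultant f g h m).map (algebraMap _ (RatFunClosure F n)) =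
      C (toClosure (resultant (inY f) (inY h) (inY f).natDegree m)) *
        (((yRoots f).map fun σ => evalY g σ / evalY h σ).map fun a => X + C a).prod := by
    rw [map_pencilResultant hf hg hh, hB, map_multiset_prod, Multiset.map_map, Multiset.map_map,
      ← Multiset.prod_map_mul]
    refine congrArg Multiset.prod (Multiset.map_congr rfl fun σ hσ => ?_)
    have h1 : evalY h σ * (evalY g σ / evalY h σ) = evalY g σ := mul_div_cancel₀ _ (h0 σ hσ)
    simp only [Function.comp_apply]
    conv_lhs => rw [← h1, C_mul]
    change _ = C (evalY h σ) * _
    ring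
  have hc := congrArg (fun P => P.coeff ((inY f).natDegree - r)) hA
  simp only [coeff_map, coeff_C_mul] at hc
  change toClosure _ = _ at hc
  rw [eq_div_iff hB0, hc, Multiset.prod_X_add_C_coeff _ (by
    rw [Multiset.card_map, card_yRoots hf]; omega), Multiset.card_map, card_yRoots hf,
    Nat.sub_sub_self hr, mul_comm]

end Roots

/-! ### Degenerate parameters and finding enough field elements. -/

theorem HasCircuit.one_le_size {F : Type u} {V : Type v} [CommSemiring F] {p : MvPolynomial V F}
    {s Δ : ℕ} (h : HasCircuit p s Δ) : 1 ≤ s := by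
  obtain ⟨C, -, hs, -⟩ := h
  have := Finset.single_le_sum (f := fun j => 1 + (C.gate j).inputs.length)
    (fun _ _ => Nat.zero_le _) (Finset.mem_univ C.output)
  exact le_trans (by simp) (this.trans hs)

/-- Serves the case `s = 1`, where `s * d * n` may be `1` and the cardinality hypothesis is then
empty. -/
theorem HasCircuit.eq_X_or_eq_C {F : Type u} {V : Type v} [CommSemiring F] {p : MvPolynomial V F}
    {Δ : ℕ} (h : HasCircuit p 1 Δ) : (∃ x, p = MvPolynomial.X x) ∨ ∃ a, p = MvPolynomial.C a := by
  obtain ⟨C, rfl, hs, -⟩ := h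
  have h1 := Finset.single_le_sum (f := fun j => 1 + (C.gate j).inputs.length)
    (fun _ _ => Nat.zero_le _) (Finset.mem_univ C.output)
  have h2 : (C.gate C.output).inputs = [] := by
    rw [← List.length_eq_zero_iff]
    have := h1.trans hs
    omega
  rw [AlgCircuit.poly, AlgCircuit.nodePoly_eq]
  cases hg : C.gate C.output with
  | var x => exact Or.inl ⟨x, rfl⟩
  | const a => exact Or.inr ⟨a, rfl⟩
  | sum l =>
    obtain rfl : l = [] := by rwa [hg] at h2
    exact Or.inr ⟨0, by rw [Gate.evalWith_sum]; simp⟩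
  | prod l =>
    obtain rfl : l = [] := by rwa [hg] at h2
    exact Or.inr ⟨1, by rw [Gate.evalWith_prod]; simp⟩

theorem HasCircuit.of_isEmpty {F : Type u} {V : Type v} [CommSemiring F] [IsEmpty V]
    (p : MvPolynomial V F) : HasCircuit p 1 0 := by
  rw [MvPolynomial.eq_C_of_isEmpty p]
  exact HasCircuit.C _

theorem exists_fin_embedding {F : Type u} {M : ℕ} (h : ((M : ℕ) : ℕ∞) ≤ ENat.card F) :
    Nonempty (Fin M ↪ F) := by
  rcases finite_or_infinite F with hF | hF
  · have := Fintype.ofFinite F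
    rw [ENat.card_eq_coe_fintype_card] at h
    exact Function.Embedding.nonempty_of_card_le (by simpa using h)
  · exact ⟨Fin.valEmbedding.trans (Infinite.natEmbedding F)⟩

/-! ### Assembly and the choice of constants. -/

section Main

variable {F : Type u} [Field F] {n : ℕ}

theorem eval_inY_eq_aeval (f : MvPolynomial (Option (Fin n)) F) (c : F) :
    (inY f).eval (MvPolynomial.C c) = MvPolynomial.aeval (fun x => Sum.elim MvPolynomial.X
      MvPolynomial.C ((Option.elim x (Sum.inr c) Sum.inl : Fin n ⊕ F))) f := by
  unfold inY
  induction f using MvPolynomial.induction_on with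
  | C a => simp [MvPolynomial.optionEquivLeft_C]
  | add p q hp hq => rw [map_add, map_add, eval_add, hp, hq]
  | mul_X p i hp =>
    rw [map_mul, map_mul, eval_mul, hp]
    cases i <;> simp [MvPolynomial.optionEquivLeft_X_none, MvPolynomial.optionEquivLeft_X_some]

theorem HasCircuit.eval_inY {f : MvPolynomial (Option (Fin n)) F} {s Δ : ℕ}
    (hf : HasCircuit f s Δ) (c : F) : HasCircuit ((inY f).eval (MvPolynomial.C c)) s Δ := by
  rw [eval_inY_eq_aeval]
  exact hf.subst _

theorem inY_one : inY (1 : MvPolynomial (Option (Fin n)) F) = 1 := map_one _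

theorem eq_X_none_of_hasCircuit_one {f : MvPolynomial (Option (Fin n)) F} {Δ : ℕ}
    (hf : HasCircuit f 1 Δ) (hd : 1 ≤ (inY f).natDegree) : inY f = X := by
  rcases hf.eq_X_or_eq_C with ⟨x, rfl⟩ | ⟨a, rfl⟩
  · cases x with
    | none => exact MvPolynomial.optionEquivLeft_X_none F (Fin n)
    | some i =>
      have : inY (MvPolynomial.X (some i) : MvPolynomial (Option (Fin n)) F) =
        C (MvPolynomial.X i) := MvPolynomial.optionEquivLeft_X_some F (Fin n) i
      rw [this, natDegree_C] at hd
      omega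
  · have : inY (MvPolynomial.C a : MvPolynomial (Option (Fin n)) F) =
      C (MvPolynomial.C a) := MvPolynomial.optionEquivLeft_C F (Fin n) a
    rw [this, natDegree_C] at hd
    omega

theorem evalY_zero (g : MvPolynomial (Option (Fin n)) F) :
    evalY g 0 = toClosure ((inY g).eval (MvPolynomial.C 0)) := by
  rw [MvPolynomial.C_0, evalY, toClosure, ← aeval_algebraMap_apply_eq_algebraMap_eval, map_zero]

/-- Circuits for the resultants of `f` with `g + t h` (by coefficients in `t`) and with `h`, over a
field with enough elements. -/
theorem circuitLevel_pencilResultant {s Δ d : ℕ} {f g h : MvPolynomial (Option (Fin n)) F}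
    (hcard : (((s + n + d + 1) ^ 4 : ℕ) : ℕ∞) ≤ ENat.card F)
    (hf : (inY f).Monic) (hfd : (inY f).natDegree ≤ d) (hg : (inY g).natDegree ≤ d)
    (hh : (inY h).natDegree ≤ d) (hf' : HasCircuit f s Δ) (hg' : HasCircuit g s Δ)
    (hh' : HasCircuit h s Δ) :
    (∀ j, CircuitLevel ((s + n + d + 1) ^ 4) Δ 48 ((pencilResultant f g h d).coeff j)) ∧
      CircuitLevel ((s + n + d + 1) ^ 4) Δ 48
        (resultant (inY f) (inY h) (inY f).natDegree d) := by
  obtain ⟨e⟩ := exists_fin_embedding hcard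
  have hs := hf'.one_le_size
  have hB : d + 2 ≤ s + n + d + 1 := by omega
  have hM4 : (d + 2) ^ 4 ≤ (s + n + d + 1) ^ 4 := Nat.pow_le_pow_left hB 4
  have hsM : s ≤ (s + n + d + 1) ^ 4 := by
    calc s ≤ s + n + d + 1 := by omega
      _ ≤ _ := Nat.le_self_pow (by norm_num) _
  have hsq : (d + 2) ^ 4 = ((d + 2) * (d + 2)) * ((d + 2) * (d + 2)) := by ring
  set M := (s + n + d + 1) ^ 4
  -- The fourth power leaves room for this quadratic degree bound and for `s`.
  have hdeg' : (d + d) * (d + 2) + 1 < M := by nlinarith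
  have hdeg : ((inY f).natDegree + d) * ((inY f).natDegree + 2) + 1 < M := by
    refine lt_of_le_of_lt ?_ hdeg'
    gcongr
  have hdM : d < M := by nlinarith
  have hM : 2 ≤ M := by nlinarith
  have level : ∀ {p : MvPolynomial (Option (Fin n)) F}, HasCircuit p s Δ →
      ∀ c, CircuitLevel M Δ 0 ((inY p).eval (MvPolynomial.C c)) := fun hp c =>
    (hp.eval_inY c).mono (by simpa using hsM) le_rfl
  refine ⟨fun j => CircuitLevel.coeff_resultant_pencil (k := 0) hM e hdeg hf rfl hg hh (level hf')
    (level hg') (level hh') j, ?_⟩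
  exact (CircuitLevel.resultant (k := 4) hM e hdeg hf rfl hh
    (CircuitLevel.coeff_of_eval hM (by omega) e (level hf'))
    (CircuitLevel.coeff_of_eval hM (by omega) e (level hh'))).mono hM (by norm_num)

/-- Common core of both parts; the clause `h = 1 → B = 1` turns the quotient into a polynomial for
the first. -/
theorem exists_hasCircuit_esymm_div {s Δ d : ℕ} {f g h : MvPolynomial (Option (Fin n)) F}
    (hcard : (((s * d * n) ^ 12 : ℕ) : ℕ∞) ≤ ENat.card F)
    (hf : (inY f).Monic) (hfd : (inY f).natDegree ≤ d) (hg : (inY g).natDegree ≤ d)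
    (hh : (inY h).natDegree ≤ d) (hf' : HasCircuit f s Δ) (hg' : HasCircuit g s Δ)
    (hh' : HasCircuit h s Δ) (h0 : ∀ σ ∈ yRoots f, evalY h σ ≠ 0) {r : ℕ} (hr1 : 1 ≤ r)
    (hr : r ≤ (inY f).natDegree) :
    ∃ A B : MvPolynomial (Fin n) F,
      HasCircuit A (196 * (s + n + d + 1) ^ 196) (Δ + 48) ∧
      HasCircuit B (196 * (s + n + d + 1) ^ 196) (Δ + 48) ∧
      B ≠ 0 ∧ (h = 1 → B = 1) ∧
      ((yRoots f).map fun σ => evalY g σ / evalY h σ).esymm r = toClosure A / toClosure B := by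
  have hs := hf'.one_le_size
  have hpow : s + n + d + 1 ≤ 196 * (s + n + d + 1) ^ 196 :=
    (Nat.le_self_pow (by norm_num) _).trans (Nat.le_mul_of_pos_left _ (by norm_num))
  by_cases hs1 : s = 1
  · subst hs1
    have hfX := eq_X_none_of_hasCircuit_one hf' (hr1.trans hr)
    have hroots : yRoots f = {0} := by rw [yRoots, hfX, aroots_X]
    obtain rfl : r = 1 := by
      rw [hfX, natDegree_X] at hr
      omega
    have hsize : 1 ≤ 196 * (1 + n + d + 1) ^ 196 := le_trans (by omega) hpow
    refine ⟨(inY g).eval (MvPolynomial.C 0), (inY h).eval (MvPolynomial.C 0),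
      (hg'.eval_inY 0).mono hsize (by omega), (hh'.eval_inY 0).mono hsize (by omega), ?_, ?_, ?_⟩
    · intro hB
      refine h0 0 (by simp [hroots]) ?_
      rw [evalY_zero, hB, toClosure, map_zero]
    · rintro rfl
      rw [inY_one, eval_one]
    · rw [hroots, ← evalY_zero, ← evalY_zero]
      simp [Multiset.esymm, Multiset.powersetCard_one]
  refine ⟨(pencilResultant f g h d).coeff ((inY f).natDegree - r),
    resultant (inY f) (inY h) (inY f).natDegree d, ?_⟩
  rw [← and_assoc]
  refine ⟨?_, ?_, ?_, esymm_div_eq hf hg hh hr h0⟩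
  -- For `n = 0` the cardinality hypothesis is void, but every polynomial is then a constant.
  · rcases Nat.eq_zero_or_pos n with rfl | hn
    · have hsize : 1 ≤ 196 * (s + 0 + d + 1) ^ 196 := le_trans (by omega) hpow
      exact ⟨(HasCircuit.of_isEmpty _).mono hsize (by omega),
        (HasCircuit.of_isEmpty _).mono hsize (by omega)⟩
    · have hd : 1 ≤ d := hr1.trans (hr.trans hfd)
      -- Now `s * d * n ≥ 2`, as `s ≥ 2`. The exponent `12 = 3 * 4` combines this cube with the
      -- fourth power required of the field.
      have hsdn : s + n + d + 1 ≤ (s * d * n) ^ 3 := by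
        have h1 : 1 ≤ s * d := Nat.mul_pos hs hd
        have hX1 : s * d ≤ s * d * n := Nat.le_mul_of_pos_right _ hn
        have hX2 : n ≤ s * d * n := Nat.le_mul_of_pos_left _ h1
        have hX3 : s ≤ s * d := Nat.le_mul_of_pos_right _ hd
        have hX4 : d ≤ s * d := Nat.le_mul_of_pos_left _ hs
        have hX5 : 2 ≤ s * d * n := by omega
        calc s + n + d + 1 ≤ 2 * 2 * (s * d * n) := by omega
          _ ≤ (s * d * n) * (s * d * n) * (s * d * n) := by gcongr
          _ = (s * d * n) ^ 3 := by ring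
      have hcard' : (((s + n + d + 1) ^ 4 : ℕ) : ℕ∞) ≤ ENat.card F := by
        refine le_trans ?_ hcard
        rw [Nat.cast_le, show 12 = 3 * 4 by norm_num, pow_mul]
        exact Nat.pow_le_pow_left hsdn 4
      obtain ⟨hA, hB⟩ := circuitLevel_pencilResultant hcard' hf hfd hg hh hf' hg' hh'
      have hsize : ((s + n + d + 1) ^ 4) ^ (48 + 1) ≤ 196 * (s + n + d + 1) ^ 196 := by
        generalize s + n + d + 1 = t
        rw [← pow_mul, show 4 * (48 + 1) = 196 by norm_num]
        generalize t ^ 196 = t'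
        omega
      exact ⟨HasCircuit.mono (hA _) hsize le_rfl, HasCircuit.mono hB hsize le_rfl⟩
  · intro hB
    have := toClosure_resultant hf (inY h) hh
    rw [hB, toClosure, map_zero] at this
    obtain ⟨σ, hσ, hσ0⟩ := Multiset.mem_map.1 (Multiset.prod_eq_zero_iff.1 this.symm)
    exact h0 σ hσ hσ0
  · rintro rfl
    rw [inY_one, resultant_one_right, coeff_natDegree, hf.leadingCoeff, one_pow]

theorem esymm_map_one {R : Type*} [CommSemiring R] {ι : Type*} (t : Multiset ι) (r : ℕ) :
    (t.map fun _ => (1 : R)).esymm r = (t.card.choose r : ℕ) := by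
  rw [Multiset.esymm, Multiset.powersetCard_map, Multiset.map_map]
  simp

end Main

theorem mainTheorem7 :
    (∃ c a b : ℕ, ∀ (F : Type u) [Field F] (n s Δ d₁ d₂ : ℕ)
      (f g : MvPolynomial (Option (Fin n)) F),
      (((s * d₁ * d₂ * n) ^ c : ℕ) : ℕ∞) ≤ ENat.card F →
      (inY f).Monic → (inY f).natDegree = d₁ →
      (inY g).Monic → (inY g).natDegree = d₂ →
      HasCircuit f s Δ → HasCircuit g s Δ →
      ∀ r : ℕ, 1 ≤ r → r ≤ d₁ →
        ∃ E : MvPolynomial (Fin n) F,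
          HasCircuit E (a * (s + n + d₁ + d₂ + 1) ^ a) (Δ + b) ∧
          ((yRoots f).map fun σ => evalY g σ).esymm r = toClosure E) ∧
    (∃ c a b : ℕ, ∀ (F : Type u) [Field F] (n s Δ df dg dh d : ℕ)
      (f g h : MvPolynomial (Option (Fin n)) F),
      d = max df (max dg dh) →
      (((s * d * n) ^ c : ℕ) : ℕ∞) ≤ ENat.card F →
      (inY f).Monic → (inY f).natDegree = df →
      (inY g).Monic → (inY g).natDegree = dg →
      (inY h).Monic → (inY h).natDegree = dh →
      IsRelPrime f h →
      HasCircuit f s Δ → HasCircuit g s Δ → HasCircuit h s Δ →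
      ∀ r : ℕ, 1 ≤ r → r ≤ df →
        ∃ A B : MvPolynomial (Fin n) F,
          HasCircuit A (a * (s + n + d + 1) ^ a) (Δ + b) ∧
          HasCircuit B (a * (s + n + d + 1) ^ a) (Δ + b) ∧
          (∀ σ ∈ yRoots f, evalY h σ ≠ 0) ∧
          B ≠ 0 ∧
          ((yRoots f).map fun σ => evalY g σ / evalY h σ).esymm r = toClosure A / toClosure B) := by
  constructor
  · refine ⟨12, 196, 48, ?_⟩
    intro F _ n s Δ d₁ d₂ f g hcard hf hfd hg hgd hf' hg' r hr1 hr
    have hs := hf'.one_le_size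
    have hone : ∀ σ : RatFunClosure F n, evalY (1 : MvPolynomial (Option (Fin n)) F) σ = 1 := by
      intro σ; rw [evalY, inY_one, map_one]
    -- For `d₂ = 0` the field may be small, but `g`, being monic, is `1`, and the answer is a
    -- binomial coefficient.
    rcases Nat.eq_zero_or_pos d₂ with rfl | hd₂
    · have hg1 : inY g = 1 := hg.natDegree_eq_zero.1 hgd
      refine ⟨MvPolynomial.C ((yRoots f).card.choose r : ℕ), (HasCircuit.C _).mono ?_ (by omega), ?_⟩
      · exact Nat.mul_pos (by norm_num) (Nat.pow_pos (by omega))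
      · have : ∀ σ : RatFunClosure F n, evalY g σ = 1 := by
          intro σ; rw [evalY, hg1, map_one]
        simp only [this, esymm_map_one, toClosure, map_natCast]
    · have hd₁ : 1 ≤ d₁ := hr1.trans hr
      have h1d : d₁ ≤ d₁ * d₂ := Nat.le_mul_of_pos_right _ hd₂
      have h2d : d₂ ≤ d₁ * d₂ := Nat.le_mul_of_pos_left _ hd₁
      have hcard' : (((s * max d₁ d₂ * n) ^ 12 : ℕ) : ℕ∞) ≤ ENat.card F := by
        refine le_trans (Nat.cast_le.2 (Nat.pow_le_pow_left ?_ 12)) hcard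
        rw [mul_assoc s d₁ d₂]
        gcongr
        exact max_le h1d h2d
      obtain ⟨A, B, hA, -, -, hB, hAB⟩ := exists_hasCircuit_esymm_div (h := 1) hcard' hf
        (hfd.trans_le (le_max_left _ _)) (hgd.trans_le (le_max_right _ _))
        (by rw [inY_one, natDegree_one]; omega) hf' hg'
        (by simpa using (HasCircuit.C (V := Option (Fin n)) (1 : F)).mono hs (Nat.zero_le Δ))
        (fun σ _ => by rw [hone]; exact one_ne_zero) hr1 (hr.trans_eq hfd.symm)
      refine ⟨A, hA.mono ?_ le_rfl, ?_⟩
      · refine Nat.mul_le_mul_left _ (Nat.pow_le_pow_left ?_ _)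
        omega
      · simpa [hone, hB rfl, toClosure] using hAB
  · refine ⟨12, 196, 48, ?_⟩
    intro F _ n s Δ df dg dh d f g h hd hcard hf hfd hg hgd hh hhd hfh hf' hg' hh' r hr1 hr
    have h0 : ∀ σ ∈ yRoots f, evalY h σ ≠ 0 := fun σ hσ => evalY_ne_zero hf hfh hσ
    obtain ⟨A, B, hA, hB, hB0, -, hAB⟩ := exists_hasCircuit_esymm_div hcard hf
      (by omega) (by omega) (by omega) hf' hg' hh' h0 hr1 (hr.trans_eq hfd.symm)
    exact ⟨A, B, hA, hB, h0, hB0, hAB⟩
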